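/- For $c\in\mathbb{R}$ and $m\in\mathbb{N}$ let $A$ be the symmetric $m\times m$ matrix with ones on the first sub- and superdiagonal and zeros elsewhere, let $B$ be the skew-symmetric $m\times m$ matrix with ones on the first superdiagonal, $-1$ on the first subdiagonal and zeros elsewhere, and let $$H_c(m)=\begin{pmatrix} A+2cI & B\\ -B & -A-2cI\end{pmatrix},$$ a real symmetric $2m\times 2m$ matrix. Eigenvalues are counted with multiplicity unless stated otherwise. (1) For every $c\in\mathbb{R}$ and every $m$, the spectrum of $H_c(m)$ is symmetric about zero: if $\lambda$ is an eigenvalue, then so is $-\lambda$, with the same multiplicity. (2) If $c\ge 1$, then $(-2|c-1|,2|c-1|)\cap\sigma(H_c(m))=\emptyset$ for all $m$. (3) Let $0\le c<1$. For every $m$ with $m(1-c)>c$ (that is, for every $m>c/(1-c)$), the interval $(-2|c-1|,2|c-1|)$ contains exactly two eigenvalues of $H_c(m)$; for the remaining finitely many $m$ it contains none. If $0<c<1$, the two eigenvalues are simple and of the form $\pm\mu_m$ with $0<\mu_m\le C e^{-m\alpha_0}$, where $\alpha_0=\operatorname{arcosh}\frac{c^2+1}{2c}$ and $C$ depends only on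 $c$. If $c=0$ (formally $\alpha_0=\infty$), they form the double eigenvalue $0$, for every $m\geq 1$. (4) For every $c\ge 0$ the interval is maximal: for all $\epsilon>0$ and $N\in\mathbb{N}$ there is $M\in\mathbb{N}$ such that for all $m\ge M$ the interval $(-2|c-1|-\epsilon,\,2|c-1|+\epsilon)$ contains at least $2N$ eigenvalues of $H_c(m)$, counted with multiplicity, and, if $c>0$, at least $2N$ distinct ones. -/

import Mathlib

namespace StableGap

/-- The symmetric `m × m` matrix with ones on the first sub- and superdiagonal, zeros elsewhere. -/
def matA (m : ℕ) : Matrix (Fin m) (Fin m) ℝ :=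
  Matrix.of fun i j =>
    if (j : ℕ) = (i : ℕ) + 1 ∨ (i : ℕ) = (j : ℕ) + 1 then 1 else 0

/-- The skew-symmetric `m × m` matrix with ones on the first superdiagonal, minus ones on the
first subdiagonal, zeros elsewhere. -/
def matB (m : ℕ) : Matrix (Fin m) (Fin m) ℝ :=
  Matrix.of fun i j =>
    if (j : ℕ) = (i : ℕ) + 1 then 1 else if (i : ℕ) = (j : ℕ) + 1 then -1 else 0

/-- The `2m × 2m` block matrix `H_c(m) = [[A + 2cI, B], [-B, -A - 2cI]]`. It is real symmetric,
so its spectrum is real. -/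
noncomputable def matH (c : ℝ) (m : ℕ) : Matrix (Fin m ⊕ Fin m) (Fin m ⊕ Fin m) ℝ :=
  Matrix.fromBlocks (matA m + (2 * c) • (1 : Matrix (Fin m) (Fin m) ℝ)) (matB m)
    (-matB m) (-matA m - (2 * c) • (1 : Matrix (Fin m) (Fin m) ℝ))

/-- The eigenvalues of `H_c(m)`, repeated according to multiplicity. -/
noncomputable def eigs (c : ℝ) (m : ℕ) : Multiset ℝ :=
  (matH c m).charpoly.roots

open Classical in
/-- The eigenvalues of `H_c(m)` lying in `I`, repeated according to multiplicity. -/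
noncomputable def eigsIn (c : ℝ) (m : ℕ) (I : Set ℝ) : Multiset ℝ :=
  (eigs c m).filter (fun x => x ∈ I)

/-- The open interval `(-2|c-1| - ε, 2|c-1| + ε)`. -/
def gap (c ε : ℝ) : Set ℝ :=
  Set.Ioo (-(2 * |c - 1|) - ε) (2 * |c - 1| + ε)

/-- The decay rate `α₀ = arcosh ((c² + 1) / (2c))`, used only for `0 < c < 1`. -/
noncomputable def alpha0 (c : ℝ) : ℝ :=
  Real.arcosh ((c ^ 2 + 1) / (2 * c))

end StableGap

namespace StableGap

open Polynomial Matrix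

/-! Write `K = A + 2cI`. Conjugation by `[[1, 1], [1, -1]]` makes `H_c(m)` block off-diagonal with
blocks `K ± B`, which are transposes of each other and bidiagonal. Hence `det (x - H) = det (x² - (K
+ B)(K - B)) = (-4)^m D_m(t)` with `t = c² + 1 - x²/4`, where `D_m` is a tridiagonal determinant
(`charpoly_matH`). The gap `|x| < 2|c-1|` is `t > 2c`.

For `t ≥ 2c > 0` the Toeplitz determinants `T_k` are positive, and `D_{k+1} = T_k (r_k - 1)` with
`r_k = T_{k+1}/T_k` increasing in `t` at slope at least 1. So there is at most one root `t > 2c`,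
decided by `r_k(2c) = c(k+2)/(k+1)`; it is exponentially close to `c² + 1` because `D_m(c² + 1) =
c^(2m)`. Below `2c`, put `t = 2c cos θ`: `D_m` alternates in sign at `θ = jπ/m`, so its roots
accumulate at `2c`, which gives maximality. -/

/-! ### Reduction to a tridiagonal determinant. -/

/-- The tridiagonal matrix with `t` on the diagonal, except for the last entry `t - 1`, and `c` on
the first sub- and superdiagonal. -/
def tridiag (c t : ℝ) (m : ℕ) : Matrix (Fin m) (Fin m) ℝ :=
  Matrix.of fun i j =>
    if i = j then (if (i : ℕ) + 1 = m then t - 1 else t)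
    else if (j : ℕ) = (i : ℕ) + 1 ∨ (i : ℕ) = (j : ℕ) + 1 then c else 0

/-- The determinants of `tridiag c t m` as polynomials in `t`. -/
noncomputable def detPoly (c : ℝ) : ℕ → ℝ[X]
  | 0 => 1
  | 1 => X - 1
  | m + 2 => X * detPoly c (m + 1) - C (c ^ 2) * detPoly c m

/-- The determinants of the tridiagonal Toeplitz matrices with `t` on the diagonal and `c` on the
first sub- and superdiagonal, as polynomials in `t`. -/
noncomputable def toeplitzPoly (c : ℝ) : ℕ → ℝ[X]
  | 0 => 1
  | 1 => X
  | m + 2 => X * toeplitzPoly c (m + 1) - C (c ^ 2) * toeplitzPoly c m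

/-- Expanding along the first row leaves the perturbed last corner in place, so the minors stay in
the same family. -/
lemma det_tridiag_add_two (c t : ℝ) (m : ℕ) :
    (tridiag c t (m + 2)).det
      = t * (tridiag c t (m + 1)).det - c ^ 2 * (tridiag c t m).det := by
  have h0 : (tridiag c t (m + 2)).submatrix Fin.succ (Fin.succAbove 0) = tridiag c t (m + 1) := by
    ext i j
    simp [tridiag, Fin.ext_iff]
  have h1 : ((tridiag c t (m + 2)).submatrix Fin.succ (Fin.succAbove 1)).det
      = c * (tridiag c t m).det := by
    rw [det_succ_column_zero, Fin.sum_univ_succ, Finset.sum_eq_zero]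
    · have : ((tridiag c t (m + 2)).submatrix Fin.succ (Fin.succAbove 1)).submatrix
          (Fin.succAbove 0) Fin.succ = tridiag c t m := by
        ext i j
        simp [tridiag, Fin.ext_iff]
      rw [this]
      simp [tridiag]
    · intro i _
      simp [tridiag, Fin.ext_iff]
  rw [det_succ_row_zero, Fin.sum_univ_succ, Fin.sum_univ_succ, Finset.sum_eq_zero]
  · rw [h0]
    simp only [Fin.succ_zero_eq_one]
    rw [h1]
    simp [tridiag]
    ring
  · intro i _
    simp [tridiag, Fin.ext_iff]

lemma det_tridiag (c t : ℝ) (m : ℕ) : (tridiag c t m).det = (detPoly c m).eval t := by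
  induction m using Nat.twoStepInduction with
  | zero => simp [detPoly]
  | one => simp [detPoly, tridiag]
  | more n ih1 ih2 => simp [detPoly, det_tridiag_add_two, ih1, ih2]

/-- With `S` the superdiagonal shift, the factors are `2(cI + S)` and its transpose. `S Sᵀ` is the
identity without its last diagonal entry, whence the corner `t - 1`. -/
lemma plus_mul_minus (c x : ℝ) (m : ℕ) :
    (x ^ 2) • (1 : Matrix (Fin m) (Fin m) ℝ) -
      (matA m + (2 * c) • 1 + matB m) * (matA m + (2 * c) • 1 - matB m)
      = (-4 : ℝ) • tridiag c (c ^ 2 + 1 - x ^ 2 / 4) m := by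
  ext i j
  have e1 : ∀ k : Fin m, (matA m + (2 * c) • 1 + matB m) i k
      = 2 * (c * (if k = i then 1 else 0) + if (k : ℕ) = i + 1 then 1 else 0) := by
    intro k
    simp only [matA, matB, Matrix.add_apply, Matrix.smul_apply, Matrix.one_apply, Matrix.of_apply,
      Fin.ext_iff, smul_eq_mul]
    split_ifs <;> first | omega | ring
  have e2 : ∀ k : Fin m, (matA m + (2 * c) • 1 - matB m) k j
      = 2 * (c * (if k = j then 1 else 0) + if (k : ℕ) = j + 1 then 1 else 0) := by
    intro k
    simp only [matA, matB, Matrix.add_apply, Matrix.sub_apply, Matrix.smul_apply, Matrix.one_apply,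
      Matrix.of_apply, Fin.ext_iff, smul_eq_mul]
    split_ifs <;> first | omega | ring
  have e3 : ∑ k : Fin m, (if (k : ℕ) = i + 1 then (1 : ℝ) else 0) *
      (if (k : ℕ) = j + 1 then 1 else 0) = if i = j ∧ (i : ℕ) + 1 < m then 1 else 0 := by
    by_cases h : (i : ℕ) + 1 < m
    · rw [Finset.sum_eq_single ⟨i + 1, h⟩]
      · simp [Fin.ext_iff, h]
      · intro k _ hk
        rw [Ne, Fin.ext_iff] at hk
        simp [hk]
      · simp
    · rw [Finset.sum_eq_zero]
      · simp [h]
      · intro k _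
        have : (k : ℕ) ≠ i + 1 := by have := k.2; omega
        simp [this]
  have e4 : ((matA m + (2 * c) • 1 + matB m) * (matA m + (2 * c) • 1 - matB m)) i j
      = 4 * (c ^ 2 * (if i = j then 1 else 0) + c * (if (i : ℕ) = j + 1 then 1 else 0)
        + c * (if (j : ℕ) = i + 1 then 1 else 0)
        + if i = j ∧ (i : ℕ) + 1 < m then 1 else 0) := by
    rw [← e3, Matrix.mul_apply]
    simp only [e1, e2]
    have : ∀ k : Fin m, 2 * (c * (if k = i then (1 : ℝ) else 0) + if (k : ℕ) = i + 1 then 1 else 0) *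
        (2 * (c * (if k = j then 1 else 0) + if (k : ℕ) = j + 1 then 1 else 0))
        = 4 * (c ^ 2 * ((if k = i then 1 else 0) * (if k = j then 1 else 0))
          + c * ((if k = i then 1 else 0) * (if (k : ℕ) = j + 1 then 1 else 0))
          + c * ((if k = j then 1 else 0) * (if (k : ℕ) = i + 1 then 1 else 0))
          + (if (k : ℕ) = i + 1 then 1 else 0) * (if (k : ℕ) = j + 1 then 1 else 0)) := by
      intro k; ring
    simp only [this, ← Finset.mul_sum, Finset.sum_add_distrib, ite_mul, one_mul, zero_mul,
      Finset.sum_ite_eq', Finset.mem_univ, if_true]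
  rw [Matrix.sub_apply, e4]
  have := i.2
  simp only [tridiag, Matrix.smul_apply, Matrix.one_apply, Matrix.of_apply, Fin.ext_iff,
    smul_eq_mul]
  split_ifs <;> first | omega | ring

lemma eval_charpoly_matH_of_ne_zero (c : ℝ) (m : ℕ) {x : ℝ} (hx : x ≠ 0) :
    (matH c m).charpoly.eval x
      = (-4) ^ m * (detPoly c m).eval (c ^ 2 + 1 - x ^ 2 / 4) := by
  rw [eval_charpoly, ← det_tridiag]
  set K := matA m + (2 * c) • (1 : Matrix (Fin m) (Fin m) ℝ) with hK
  set P : Matrix (Fin m ⊕ Fin m) (Fin m ⊕ Fin m) ℝ := fromBlocks 1 1 1 (-1) with hP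
  set F : Matrix (Fin m ⊕ Fin m) (Fin m ⊕ Fin m) ℝ :=
    fromBlocks (x • 1) (-(K - matB m)) (-(K + matB m)) (x • 1) with hF
  have hH : scalar _ x - matH c m = fromBlocks (x • 1 - K) (-matB m) (matB m) (x • 1 + K) := by
    have : (scalar (Fin m ⊕ Fin m) x) = fromBlocks (x • 1) 0 0 (x • 1) := by
      ext (a | a) (b | b) <;> simp [Matrix.one_apply, Matrix.diagonal_apply]
    rw [this, matH, sub_eq_add_neg, fromBlocks_neg, fromBlocks_add]
    congr 1 <;> simp [hK] ; abel
  have hPP : P * P = (2 : ℝ) • 1 := by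
    rw [hP, fromBlocks_multiply, ← fromBlocks_one, fromBlocks_smul]
    congr 1 <;> simp [two_smul]
  have hPF : P * (scalar _ x - matH c m) * P = (2 : ℝ) • F := by
    rw [hH, hP, hF, fromBlocks_multiply, fromBlocks_multiply, fromBlocks_smul]
    congr 1 <;> simp [two_smul] <;> abel
  have hdet : F.det = (scalar _ x - matH c m).det := by
    have h1 := congrArg det hPF
    have h2 := congrArg det hPP
    rw [det_mul, det_mul, det_smul] at h1
    rw [det_mul, det_smul, det_one, mul_one] at h2
    have h3 : (2 : ℝ) ^ Fintype.card (Fin m ⊕ Fin m) ≠ 0 := by positivity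
    apply mul_left_cancel₀ h3
    rw [← h1, ← h2]; ring
  rw [← hdet, hF]
  have hinv : (x • (1 : Matrix (Fin m) (Fin m) ℝ)) * (x⁻¹ • 1) = 1 := by
    simp [smul_smul, hx]
  have hinv' : (x⁻¹ • (1 : Matrix (Fin m) (Fin m) ℝ)) * (x • 1) = 1 := by
    simp [smul_smul, hx]
  let : Invertible (x • (1 : Matrix (Fin m) (Fin m) ℝ)) := ⟨_, hinv', hinv⟩
  rw [det_fromBlocks₁₁]
  change (x • (1 : Matrix (Fin m) (Fin m) ℝ)).det *
    (x • 1 - -(K + matB m) * (x⁻¹ • (1 : Matrix (Fin m) (Fin m) ℝ)) * -(K - matB m)).det = _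
  rw [← det_mul]
  have : x • (1 : Matrix (Fin m) (Fin m) ℝ) * (x • 1 - -(K + matB m) *
      (x⁻¹ • (1 : Matrix (Fin m) (Fin m) ℝ)) * -(K - matB m))
      = (x ^ 2) • (1 : Matrix (Fin m) (Fin m) ℝ) - (K + matB m) * (K - matB m) := by
    generalize K + matB m = L
    generalize K - matB m = M
    simp [smul_sub, smul_smul, hx, pow_two]
  rw [this, plus_mul_minus, det_smul]
  simp

lemma charpoly_matH (c : ℝ) (m : ℕ) :
    (matH c m).charpoly
      = C ((-4) ^ m) * (detPoly c m).comp (C (c ^ 2 + 1) - C (1 / 4) * X ^ 2) := by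
  apply eq_of_infinite_eval_eq
  -- The Schur complement divides by `x`, so only `x = 0` is missing; infinitely many agreements
  -- suffice.
  apply (Set.finite_singleton (0 : ℝ)).infinite_compl.mono
  intro x hx
  have := eval_charpoly_matH_of_ne_zero c m (x := x) hx
  simp only [Set.mem_ofPred_eq, eval_mul, eval_C, eval_comp, eval_sub, eval_pow, eval_X, this]
  ring_nf

/-! ### Symmetry and simplicity of the spectrum. -/

lemma detPoly_succ (c : ℝ) (m : ℕ) :
    detPoly c (m + 1) = toeplitzPoly c (m + 1) - toeplitzPoly c m := by
  induction m using Nat.twoStepInduction with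
  | zero => simp [detPoly, toeplitzPoly]
  | one => simp [detPoly, toeplitzPoly]; ring
  | more n ih1 ih2 =>
    rw [detPoly, ih1, ih2, toeplitzPoly, toeplitzPoly, toeplitzPoly]; ring

lemma eval_detPoly_sq_add_one (c : ℝ) (m : ℕ) :
    (detPoly c m).eval (c ^ 2 + 1) = c ^ (2 * m) := by
  induction m using Nat.twoStepInduction with
  | zero => simp [detPoly]
  | one => simp [detPoly]
  | more n ih1 ih2 => simp [detPoly, ih1, ih2]; ring

/-- Christoffel–Darboux positivity: each step of the recursion multiplies the Wronskian by `c²` and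
adds a square. At a double root of `detPoly` it would vanish. -/
lemma wronskian_toeplitzPoly_pos {c : ℝ} (hc : c ≠ 0) (t : ℝ) (m : ℕ) :
    0 < (derivative (toeplitzPoly c (m + 1))).eval t * (toeplitzPoly c m).eval t
      - (toeplitzPoly c (m + 1)).eval t * (derivative (toeplitzPoly c m)).eval t := by
  induction m with
  | zero => simp [toeplitzPoly]
  | succ n ih =>
    have h : (derivative (toeplitzPoly c (n + 2))).eval t * (toeplitzPoly c (n + 1)).eval t
        - (toeplitzPoly c (n + 2)).eval t * (derivative (toeplitzPoly c (n + 1))).eval t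
        = (toeplitzPoly c (n + 1)).eval t ^ 2
          + c ^ 2 * ((derivative (toeplitzPoly c (n + 1))).eval t * (toeplitzPoly c n).eval t
          - (toeplitzPoly c (n + 1)).eval t * (derivative (toeplitzPoly c n)).eval t) := by
      simp only [toeplitzPoly, derivative_sub, derivative_mul, derivative_X, derivative_C,
        eval_sub, eval_mul, eval_add, eval_X, eval_C, one_mul, zero_mul, zero_add]
      ring
    rw [h]
    positivity

lemma eval_derivative_detPoly_ne_zero {c t : ℝ} (hc : c ≠ 0) {m : ℕ}
    (h : (detPoly c m).eval t = 0) : (derivative (detPoly c m)).eval t ≠ 0 := by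
  cases m with
  | zero => simp [detPoly] at h
  | succ n =>
    intro h'
    have hw := wronskian_toeplitzPoly_pos hc t n
    rw [detPoly_succ] at h h'
    rw [derivative_sub, eval_sub, sub_eq_zero] at h'
    rw [eval_sub, sub_eq_zero] at h
    rw [h, h'] at hw
    linarith [mul_comm ((derivative (toeplitzPoly c n)).eval t) ((toeplitzPoly c n).eval t)]

lemma mem_spectrum_matH (c x : ℝ) (m : ℕ) :
    x ∈ spectrum ℝ (matH c m) ↔ (detPoly c m).eval (c ^ 2 + 1 - x ^ 2 / 4) = 0 := by
  rw [Matrix.mem_spectrum_iff_isRoot_charpoly, IsRoot, charpoly_matH]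
  simp only [eval_mul, eval_C, eval_comp, eval_sub, eval_pow, eval_X]
  rw [mul_eq_zero, or_iff_right (by positivity)]
  ring_nf

lemma mem_eigs (c x : ℝ) (m : ℕ) : x ∈ eigs c m ↔ x ∈ spectrum ℝ (matH c m) := by
  rw [eigs, mem_roots (matH c m).charpoly_monic.ne_zero,
    Matrix.mem_spectrum_iff_isRoot_charpoly]

lemma neg_mem_spectrum_matH (c x : ℝ) (m : ℕ) :
    x ∈ spectrum ℝ (matH c m) ↔ -x ∈ spectrum ℝ (matH c m) := by
  simp [mem_spectrum_matH]

lemma count_eigs_neg (c x : ℝ) (m : ℕ) : (eigs c m).count x = (eigs c m).count (-x) := by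
  have h : (matH c m).charpoly.comp (-X) = (matH c m).charpoly := by
    rw [charpoly_matH, mul_comp, C_comp, comp_assoc]
    simp
  have h' : eigs c m = (eigs c m).map fun y => -y := by
    rw [eigs, ← roots_comp_neg_X, h]
  conv_rhs => rw [h']
  exact (Multiset.count_map_eq_count' _ _ neg_injective x).symm

lemma nodup_eigs {c : ℝ} (hc : c ≠ 0) (m : ℕ) : (eigs c m).Nodup := by
  rw [Multiset.nodup_iff_count_le_one]
  intro x
  rw [eigs, count_roots]
  by_contra! h
  rw [one_lt_rootMultiplicity_iff_isRoot (matH c m).charpoly_monic.ne_zero] at h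
  obtain ⟨h1, h2⟩ := h
  rw [← Matrix.mem_spectrum_iff_isRoot_charpoly, mem_spectrum_matH] at h1
  -- The chain rule contributes a factor `-x/2`, so zero must be excluded as an eigenvalue.
  have hx : x ≠ 0 := by
    intro hx
    rw [hx, zero_pow two_ne_zero, zero_div, sub_zero, eval_detPoly_sq_add_one] at h1
    exact pow_ne_zero _ hc h1
  have h3 := eval_derivative_detPoly_ne_zero hc h1
  rw [IsRoot, charpoly_matH, derivative_C_mul, derivative_comp, derivative_sub, derivative_C,
    derivative_C_mul_X_pow] at h2
  have e : c ^ 2 + 1 - 1 / 4 * x ^ 2 = c ^ 2 + 1 - x ^ 2 / 4 := by ring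
  simp [-one_div, -map_add, e, h3, hx] at h2

/-! ### Eigenvalues inside the gap for `c > 0`. -/

/-- The quotients of consecutive values of `toeplitzPoly c` at `t`. -/
noncomputable def ratio (c t : ℝ) : ℕ → ℝ
  | 0 => t
  | k + 1 => t - c ^ 2 / ratio c t k

/-- `c` is the fixed point of `r ↦ 2c - c²/r`, and the map is increasing for `r > 0`. -/
lemma lt_ratio {c t : ℝ} (hc : 0 < c) (ht : 2 * c ≤ t) (k : ℕ) : c < ratio c t k := by
  induction k with
  | zero => rw [ratio]; linarith
  | succ n ih =>
    have : c ^ 2 / ratio c t n < c := by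
      rw [div_lt_iff₀ (hc.trans ih)]; nlinarith
    rw [ratio]; linarith

lemma eval_toeplitzPoly_succ {c t : ℝ} (hc : 0 < c) (ht : 2 * c ≤ t) (k : ℕ) :
    (toeplitzPoly c (k + 1)).eval t = ratio c t k * (toeplitzPoly c k).eval t := by
  induction k with
  | zero => simp [toeplitzPoly, ratio]
  | succ n ih =>
    have := (hc.trans (lt_ratio hc ht n)).ne'
    rw [toeplitzPoly, eval_sub, eval_mul, eval_mul, ih, ratio]
    simp only [eval_X, eval_C]
    field_simp

lemma eval_toeplitzPoly_pos {c t : ℝ} (hc : 0 < c) (ht : 2 * c ≤ t) (k : ℕ) :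
    0 < (toeplitzPoly c k).eval t := by
  induction k with
  | zero => simp [toeplitzPoly]
  | succ n ih =>
    rw [eval_toeplitzPoly_succ hc ht]
    exact mul_pos (hc.trans (lt_ratio hc ht n)) ih

lemma sub_le_ratio_sub {c t t' : ℝ} (hc : 0 < c) (ht : 2 * c ≤ t) (htt : t ≤ t') (k : ℕ) :
    t' - t ≤ ratio c t' k - ratio c t k := by
  induction k with
  | zero => simp [ratio]
  | succ n ih =>
    have h := lt_ratio hc ht n
    have : c ^ 2 / ratio c t' n ≤ c ^ 2 / ratio c t n :=
      div_le_div_of_nonneg_left (by positivity) (hc.trans h) (by linarith)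
    rw [ratio, ratio]; linarith

lemma ratio_two_mul {c : ℝ} (hc : 0 < c) (k : ℕ) :
    ratio c (2 * c) k = c * (k + 2) / (k + 1) := by
  induction k with
  | zero => simp [ratio]; ring
  | succ n ih =>
    rw [ratio, ih]; push_cast; field_simp; ring

lemma eval_detPoly_succ {c t : ℝ} (hc : 0 < c) (ht : 2 * c ≤ t) (k : ℕ) :
    (detPoly c (k + 1)).eval t = (toeplitzPoly c k).eval t * (ratio c t k - 1) := by
  rw [detPoly_succ, eval_sub, eval_toeplitzPoly_succ hc ht]; ring

lemma eval_detPoly_succ_eq_zero {c t : ℝ} (hc : 0 < c) (ht : 2 * c ≤ t) (k : ℕ) :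
    (detPoly c (k + 1)).eval t = 0 ↔ ratio c t k = 1 := by
  rw [eval_detPoly_succ hc ht, mul_eq_zero,
    or_iff_right (eval_toeplitzPoly_pos hc ht k).ne', sub_eq_zero]

lemma one_le_eval_toeplitzPoly (c : ℝ) (k : ℕ) :
    1 ≤ (toeplitzPoly c k).eval (c ^ 2 + 1) := by
  induction k with
  | zero => simp [toeplitzPoly]
  | succ n ih =>
    have h := eval_detPoly_sq_add_one c (n + 1)
    rw [detPoly_succ, eval_sub] at h
    have : 0 ≤ c ^ (2 * (n + 1)) := (even_two_mul _).pow_nonneg c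
    linarith

lemma mem_gap_zero (c x : ℝ) : x ∈ gap c 0 ↔ 2 * c < c ^ 2 + 1 - x ^ 2 / 4 := by
  have h : x ∈ gap c 0 ↔ |x| < |2 * (c - 1)| := by
    rw [gap, Set.mem_Ioo, abs_lt, abs_mul, abs_two, sub_zero, add_zero]
  rw [h, ← sq_lt_sq]
  constructor <;> intro h <;> nlinarith

lemma gap_inter_spectrum_eq_empty {c : ℝ} (hc : 0 < c) {m : ℕ} (hm : m * (1 - c) ≤ c) :
    gap c 0 ∩ spectrum ℝ (matH c m) = ∅ := by
  rw [Set.eq_empty_iff_forall_notMem]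
  rintro x ⟨hx, hs⟩
  rw [mem_gap_zero] at hx
  rw [mem_spectrum_matH] at hs
  cases m with
  | zero => simp [detPoly] at hs
  | succ n =>
    rw [eval_detPoly_succ_eq_zero hc hx.le] at hs
    have h1 := sub_le_ratio_sub hc le_rfl hx.le n
    -- With `m = n + 1`, the bound `m(1-c) ≤ c` says exactly `c(n+2)/(n+1) ≥ 1`; strict growth then
    -- excludes `r_n = 1` beyond `2c`.
    have h2 : 1 ≤ ratio c (2 * c) n := by
      rw [ratio_two_mul hc, le_div_iff₀ (by positivity)]
      push_cast at hm
      linarith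
    linarith

lemma exp_neg_mul_alpha0 {c : ℝ} (h0 : 0 < c) (h1 : c < 1) (m : ℕ) :
    Real.exp (-(m * alpha0 c)) = c ^ m := by
  have h : alpha0 c = -Real.log c := by
    have : (c ^ 2 + 1) / (2 * c) = Real.cosh (-Real.log c) := by
      rw [Real.cosh_neg, Real.cosh_log h0]; field_simp
    rw [alpha0, this, Real.arcosh_cosh]
    linarith [Real.log_neg h0 h1]
  rw [h, mul_neg, neg_neg, Real.exp_nat_mul, Real.exp_log h0]

lemma exists_eigsIn_gap_eq {c : ℝ} (h0 : 0 < c) (h1 : c < 1) {m : ℕ} (hm : c < m * (1 - c)) :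
    ∃ μ : ℝ, 0 < μ ∧ μ ≤ 2 * c ^ m ∧ eigsIn c m (gap c 0) = {-μ, μ} := by
  cases m with
  | zero => norm_num at hm; linarith
  | succ n =>
    have hlt : 2 * c < c ^ 2 + 1 := by nlinarith [sq_pos_of_pos (sub_pos.2 h1)]
    have ha : (detPoly c (n + 1)).eval (2 * c) < 0 := by
      rw [eval_detPoly_succ h0 le_rfl]
      refine mul_neg_of_pos_of_neg (eval_toeplitzPoly_pos h0 le_rfl n) ?_
      rw [sub_neg, ratio_two_mul h0, div_lt_one (by positivity)]
      push_cast at hm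
      linarith
    have hb : 0 < (detPoly c (n + 1)).eval (c ^ 2 + 1) := by
      rw [eval_detPoly_sq_add_one]; positivity
    obtain ⟨t, ⟨ht1, ht2⟩, ht⟩ := intermediate_value_Ioo hlt.le
      (detPoly c (n + 1)).continuous.continuousOn ⟨ha, hb⟩
    have ht' := (eval_detPoly_succ_eq_zero h0 ht1.le n).1 ht
    have hy : 0 < c ^ 2 + 1 - t := by linarith
    have hsq : (2 * √(c ^ 2 + 1 - t)) ^ 2 = 4 * (c ^ 2 + 1 - t) := by
      rw [mul_pow, Real.sq_sqrt hy.le]; norm_num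
    set μ := 2 * √(c ^ 2 + 1 - t) with hμ
    have hμ0 : 0 < μ := by positivity
    refine ⟨μ, hμ0, ?_, ?_⟩
    · have h2 := sub_le_ratio_sub h0 ht1.le ht2.le n
      have h3 := eval_detPoly_sq_add_one c (n + 1)
      -- `c^(2m) = T_n(c²+1) (r_n(c²+1) - 1)`, with `T_n(c²+1) ≥ 1` and `r_n(t) = 1`, so slope at
      -- least 1 gives `c² + 1 - t ≤ c^(2m)`. Since `μ = 2√(c² + 1 - t)`, this yields the constant
      -- 2.
      rw [eval_detPoly_succ h0 hlt.le] at h3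
      have h4 := one_le_eval_toeplitzPoly c n
      have h5 : c ^ 2 + 1 - t ≤ (c ^ (n + 1)) ^ 2 := by
        rw [← pow_mul, mul_comm (n + 1), ← h3]
        nlinarith
      rw [hμ]
      exact mul_le_mul_of_nonneg_left (Real.sqrt_le_iff.2 ⟨by positivity, h5⟩) zero_le_two
    · classical
      have hnd : ({-μ, μ} : Multiset ℝ).Nodup := by
        simp only [Multiset.insert_eq_cons, Multiset.nodup_cons, Multiset.mem_singleton,
          Multiset.nodup_singleton, and_true]
        linarith
      refine (Multiset.Nodup.ext ((nodup_eigs h0.ne' _).filter _) hnd).2 fun x => ?_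
      rw [Multiset.mem_filter, mem_eigs, mem_spectrum_matH, mem_gap_zero]
      simp only [Multiset.insert_eq_cons, Multiset.mem_cons, Multiset.mem_singleton]
      have hiff : x = -μ ∨ x = μ ↔ c ^ 2 + 1 - x ^ 2 / 4 = t := by
        rw [or_comm, ← sq_eq_sq_iff_eq_or_eq_neg, hsq]
        constructor <;> intro h <;> linarith
      rw [hiff]
      constructor
      · rintro ⟨hx1, hx2⟩
        rw [eval_detPoly_succ_eq_zero h0 hx2.le] at hx1
        rcases le_total t (c ^ 2 + 1 - x ^ 2 / 4) with h | h
        · linarith [sub_le_ratio_sub h0 ht1.le h n]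
        · linarith [sub_le_ratio_sub h0 hx2.le h n]
      · intro h
        rw [h]
        exact ⟨ht, ht1⟩

/-! ### The explicit spectrum for `c = 0`. -/

lemma detPoly_zero_succ (n : ℕ) : detPoly 0 (n + 1) = X ^ n * (X - 1) := by
  induction n with
  | zero => simp [detPoly]
  | succ n ih => rw [detPoly, ih]; simp; ring

lemma eigs_zero_succ (n : ℕ) : eigs 0 (n + 1) = {0, 0} + n • ({2} + {-2}) := by
  have h : (matH 0 (n + 1)).charpoly = X ^ 2 * ((X - C 2) * (X - C (-2))) ^ n := by
    apply Polynomial.funext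
    intro x
    rw [charpoly_matH, detPoly_zero_succ]
    have h : (x - 2) * (x - -2) = -4 * (0 ^ 2 + 1 - 1 / 4 * x ^ 2) := by ring
    simp only [mul_comp, pow_comp, X_comp, sub_comp, one_comp, eval_mul, eval_pow, eval_C,
      eval_sub, eval_X, eval_one]
    rw [h, mul_pow]
    ring
  have h2 : ((X - C 2) * (X - C (-2)) : ℝ[X]) ≠ 0 :=
    mul_ne_zero (X_sub_C_ne_zero _) (X_sub_C_ne_zero _)
  rw [eigs, h, roots_mul (mul_ne_zero (pow_ne_zero _ X_ne_zero) (pow_ne_zero _ h2)), roots_X_pow,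
    roots_pow, roots_mul h2, roots_X_sub_C, roots_X_sub_C]
  rfl

lemma eigsIn_zero_gap {m : ℕ} (hm : 1 ≤ m) : eigsIn 0 m (gap 0 0) = {0, 0} := by
  obtain ⟨n, rfl⟩ := Nat.exists_eq_add_of_le' hm
  rw [eigsIn, eigs_zero_succ, Multiset.filter_add, Multiset.filter_nsmul, Multiset.filter_add]
  simp [gap, Multiset.filter_singleton, Multiset.insert_eq_cons]

lemma card_eigsIn_zero {ε : ℝ} (hε : 0 < ε) {m : ℕ} (hm : 1 ≤ m) :
    Multiset.card (eigsIn 0 m (gap 0 ε)) = 2 * m := by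
  obtain ⟨n, rfl⟩ := Nat.exists_eq_add_of_le' hm
  have h : eigsIn 0 (n + 1) (gap 0 ε) = eigs 0 (n + 1) := by
    classical
    refine Multiset.filter_eq_self.2 fun x hx => ?_
    rw [eigs_zero_succ, Multiset.mem_add] at hx
    rcases hx with hx | hx
    · have : x = 0 := by simpa using hx
      subst this
      simp [gap]; constructor <;> linarith
    · have := Multiset.mem_of_mem_nsmul hx
      simp at this
      rcases this with rfl | rfl <;> simp [gap] <;> constructor <;> linarith
  rw [h, eigs_zero_succ]
  simp
  ring

/-! ### Maximality: roots accumulating at `t = 2c`. -/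

lemma eval_toeplitzPoly_cos (c θ : ℝ) (k : ℕ) :
    (toeplitzPoly c k).eval (2 * c * Real.cos θ) * Real.sin θ
      = c ^ k * Real.sin ((k + 1) * θ) := by
  induction k using Nat.twoStepInduction with
  | zero => simp [toeplitzPoly]
  | one => norm_num [toeplitzPoly, Real.sin_two_mul]; ring
  | more n ih1 ih2 =>
    have h : Real.sin ((n + 2 + 1) * θ)
        = 2 * Real.cos θ * Real.sin ((n + 1 + 1) * θ) - Real.sin ((n + 1) * θ) := by
      have e1 : (n + 2 + 1 : ℝ) * θ = (n + 1 + 1) * θ + θ := by ring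
      have e2 : (n + 1 : ℝ) * θ = (n + 1 + 1) * θ - θ := by ring
      rw [e1, e2, Real.sin_add, Real.sin_sub]; ring
    push_cast at ih2 ⊢
    rw [h, toeplitzPoly, eval_sub, eval_mul, eval_mul, sub_mul, mul_assoc _ _ (Real.sin θ), ih2,
      mul_assoc _ _ (Real.sin θ), ih1]
    simp only [eval_X, eval_C]
    ring

/-- At `θ = jπ/m` the term `T_{m-1}` vanishes and `sin((m+1)θ) = (-1)^j sin θ`. -/
lemma eval_detPoly_cos (c : ℝ) {m j : ℕ} (hj : 0 < j) (hjm : j < m) :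
    (detPoly c m).eval (2 * c * Real.cos (j * (Real.pi / m))) = (-1) ^ j * c ^ m := by
  obtain ⟨n, rfl⟩ := Nat.exists_eq_add_of_le' (hj.trans hjm)
  set θ := j * (Real.pi / (n + 1 : ℕ)) with hθ
  have hsin : 0 < Real.sin θ := by
    apply Real.sin_pos_of_pos_of_lt_pi
    · positivity
    · have : (j : ℝ) < (n + 1 : ℕ) := by exact_mod_cast hjm
      rw [hθ, mul_div_assoc', div_lt_iff₀ (by positivity), mul_comm]
      exact mul_lt_mul_of_pos_left this Real.pi_pos
  have e : (n + 1 : ℝ) * θ = j * Real.pi := by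
    rw [hθ]; push_cast; field_simp
  have h1 := eval_toeplitzPoly_cos c θ n
  have h2 := eval_toeplitzPoly_cos c θ (n + 1)
  rw [e, Real.sin_nat_mul_pi] at h1
  push_cast at h2
  rw [add_mul, e, one_mul, add_comm (_ * _) θ, Real.sin_add_nat_mul_pi] at h2
  apply mul_right_cancel₀ hsin.ne'
  rw [detPoly_succ, eval_sub, sub_mul, h1, h2]
  ring

lemma exists_root_detPoly_cos {c : ℝ} (hc : 0 < c) {m j : ℕ} (hj : 0 < j) (hjm : j + 1 < m) :
    ∃ θ, j * (Real.pi / m) < θ ∧ θ < (j + 1) * (Real.pi / m) ∧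
      (detPoly c m).eval (2 * c * Real.cos θ) = 0 := by
  have h1 := eval_detPoly_cos c hj (by omega : j < m)
  have h2 := eval_detPoly_cos c (by omega : 0 < j + 1) hjm
  rw [pow_succ] at h2
  push_cast at h2
  have hcont : ContinuousOn (fun θ => (detPoly c m).eval (2 * c * Real.cos θ))
      (Set.Icc (j * (Real.pi / m)) ((j + 1) * (Real.pi / m))) := by
    have := (detPoly c m).continuous
    fun_prop
  have hle : (j : ℝ) * (Real.pi / m) ≤ (j + 1) * (Real.pi / m) := by
    have := Real.pi_pos
    gcongr
    linarith
  have hp : 0 < c ^ m := by positivity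
  rcases neg_one_pow_eq_or ℝ j with h | h
  · rw [h] at h1 h2
    obtain ⟨θ, hθ, h0⟩ := intermediate_value_Ioo' hle hcont
      (show (0 : ℝ) ∈ Set.Ioo _ _ from ⟨by rw [h2]; linarith, by rw [h1]; linarith⟩)
    exact ⟨θ, hθ.1, hθ.2, h0⟩
  · rw [h] at h1 h2
    obtain ⟨θ, hθ, h0⟩ := intermediate_value_Ioo hle hcont
      (show (0 : ℝ) ∈ Set.Ioo _ _ from ⟨by rw [h1]; linarith, by rw [h2]; linarith⟩)
    exact ⟨θ, hθ.1, hθ.2, h0⟩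

lemma mem_gap_of_sq_lt {c ε x : ℝ} (hε : 0 < ε) (h : x ^ 2 < (2 * |c - 1| + ε) ^ 2) :
    x ∈ gap c ε := by
  have := abs_lt_of_sq_lt_sq' h (by positivity)
  exact ⟨by linarith [this.1], this.2⟩

lemma finite_gap_inter_spectrum (c ε : ℝ) (m : ℕ) :
    (gap c ε ∩ spectrum ℝ (matH c m)).Finite := by
  refine (eigs c m).toFinset.finite_toSet.subset fun x hx => ?_
  simpa [mem_eigs] using hx.2

lemma ncard_le_card_eigsIn (c ε : ℝ) (m : ℕ) :
    (gap c ε ∩ spectrum ℝ (matH c m)).ncard ≤ Multiset.card (eigsIn c m (gap c ε)) := by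
  have : gap c ε ∩ spectrum ℝ (matH c m) = (eigsIn c m (gap c ε)).toFinset := by
    ext x
    simp [eigsIn, mem_eigs, and_comm]
  rw [this, Set.ncard_coe_finset]
  exact Multiset.toFinset_card_le _

/-- Each of the `N` intervals between consecutive nodes `jπ/m`, `1 ≤ j ≤ N + 1`, supplies a root and
hence a pair `±2√y`. Condition `hcos` bounds `y` at the last node, and `y` increases with `θ`. -/
lemma two_mul_le_ncard {c ε : ℝ} (hc : 0 < c) (hε : 0 < ε) {m N : ℕ} (hm : N + 1 < m)
    (hcos : c ^ 2 + 1 - 2 * c * Real.cos ((N + 1) * (Real.pi / m)) < (|c - 1| + ε / 2) ^ 2) :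
    2 * N ≤ (gap c ε ∩ spectrum ℝ (matH c m)).ncard := by
  have hex : ∀ j : Fin N, ∃ θ, ((j : ℕ) + 1 : ℝ) * (Real.pi / m) < θ ∧
      θ < ((j : ℕ) + 1 + 1) * (Real.pi / m) ∧ (detPoly c m).eval (2 * c * Real.cos θ) = 0 := by
    intro j
    have := exists_root_detPoly_cos hc (m := m) (j := j + 1) (by omega) (by omega)
    push_cast at this
    exact this
  choose θ h1 h2 h3 using hex
  have hm0 : (0 : ℝ) < m := by exact_mod_cast (by omega : 0 < m)
  have hd : 0 < Real.pi / m := div_pos Real.pi_pos hm0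
  have hpos : ∀ j, 0 < θ j := fun j => lt_trans (by positivity) (h1 j)
  have hend : ((N : ℝ) + 1) * (Real.pi / m) < Real.pi := by
    have : (N + 1 : ℝ) < m := by exact_mod_cast hm
    rw [mul_div_assoc', div_lt_iff₀ hm0, mul_comm]
    exact mul_lt_mul_of_pos_left this Real.pi_pos
  have hlt : ∀ j, θ j < (N + 1) * (Real.pi / m) := fun j => by
    refine (h2 j).trans_le (mul_le_mul_of_nonneg_right ?_ hd.le)
    have : ((j : ℕ) + 1 : ℝ) ≤ N := by exact_mod_cast j.2
    linarith
  have hmono : StrictMono θ := fun i j hij => by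
    refine (h2 i).trans_le (le_trans (mul_le_mul_of_nonneg_right ?_ hd.le) (h1 j).le)
    have : ((i : ℕ) + 1 : ℝ) ≤ (j : ℕ) := by exact_mod_cast hij
    linarith
  set y : Fin N → ℝ := fun j => c ^ 2 + 1 - 2 * c * Real.cos (θ j) with hy
  have hy0 : ∀ j, 0 < y j := fun j => by
    have : Real.cos (θ j) < 1 := by
      rw [← Real.cos_zero]
      exact Real.cos_lt_cos_of_nonneg_of_le_pi le_rfl ((hlt j).trans hend).le (hpos j)
    simp only [hy]
    nlinarith [sq_nonneg (c - 1), mul_pos hc (sub_pos.2 this)]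
  have hyinj : Function.Injective y := fun i j hij => by
    apply hmono.injective
    apply Real.injOn_cos ⟨(hpos i).le, ((hlt i).trans hend).le⟩
      ⟨(hpos j).le, ((hlt j).trans hend).le⟩
    have : 2 * c * Real.cos (θ i) = 2 * c * Real.cos (θ j) := by
      simp only [hy] at hij; linarith
    exact mul_left_cancel₀ (by positivity) this
  have hylt : ∀ j, y j < (|c - 1| + ε / 2) ^ 2 := fun j => by
    refine lt_of_le_of_lt ?_ hcos
    have : Real.cos ((N + 1) * (Real.pi / m)) ≤ Real.cos (θ j) :=
      Real.cos_le_cos_of_nonneg_of_le_pi (hpos j).le hend.le (hlt j).le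
    simp only [hy]
    nlinarith
  set f : Fin N × Bool → ℝ := fun p => (if p.2 then 1 else -1) * (2 * √(y p.1)) with hf
  have hfsq : ∀ p, f p ^ 2 = 4 * y p.1 := fun p => by
    simp only [hf, mul_pow, Real.sq_sqrt (hy0 p.1).le]
    split_ifs <;> norm_num
  have hfinj : Function.Injective f := by
    rintro ⟨i, a⟩ ⟨j, b⟩ hab
    have h4 : i = j := by
      apply hyinj
      have := congrArg (· ^ 2) hab
      simp only [hfsq] at this
      linarith
    subst h4
    have h5 : 0 < √(y i) := Real.sqrt_pos.2 (hy0 i)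
    simp only [hf] at hab
    cases a <;> cases b <;> simp at hab ⊢ <;> linarith
  have hsub : Set.range f ⊆ gap c ε ∩ spectrum ℝ (matH c m) := by
    rintro _ ⟨p, rfl⟩
    refine ⟨mem_gap_of_sq_lt hε ?_, ?_⟩
    · rw [hfsq]
      nlinarith [hylt p.1]
    · rw [mem_spectrum_matH, hfsq]
      have : c ^ 2 + 1 - 4 * y p.1 / 4 = 2 * c * Real.cos (θ p.1) := by simp only [hy]; ring
      rw [this, h3]
  have hcard : (Set.range f).ncard = 2 * N := by
    rw [← Set.image_univ, Set.ncard_image_of_injective _ hfinj, Set.ncard_univ]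
    simp [mul_comm]
  rw [← hcard]
  exact Set.ncard_le_ncard hsub (finite_gap_inter_spectrum c ε m)

lemma exists_forall_two_mul_le_ncard {c ε : ℝ} (hc : 0 < c) (hε : 0 < ε) (N : ℕ) :
    ∃ M : ℕ, ∀ m : ℕ, M ≤ m → 2 * N ≤ (gap c ε ∩ spectrum ℝ (matH c m)).ncard := by
  have hlim : Filter.Tendsto
      (fun m : ℕ => c ^ 2 + 1 - 2 * c * Real.cos ((N + 1) * (Real.pi / m))) Filter.atTop
      (nhds (c ^ 2 + 1 - 2 * c * Real.cos ((N + 1) * 0))) :=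
    tendsto_const_nhds.sub (((Real.continuous_cos.tendsto _).comp
      ((tendsto_const_div_atTop_nhds_zero_nat Real.pi).const_mul _)).const_mul _)
  -- In the limit the left side is `(c - 1)²`.
  have hlt : c ^ 2 + 1 - 2 * c * Real.cos ((N + 1) * 0) < (|c - 1| + ε / 2) ^ 2 := by
    rw [mul_zero, Real.cos_zero]
    nlinarith [abs_nonneg (c - 1), sq_abs (c - 1), mul_nonneg (abs_nonneg (c - 1)) hε.le]
  obtain ⟨M, hM⟩ := Filter.eventually_atTop.1
    ((hlim.eventually_lt_const hlt).and (Filter.eventually_gt_atTop (N + 1)))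
  exact ⟨M, fun m hm => two_mul_le_ncard hc hε (hM m hm).2 (hM m hm).1⟩

end StableGap

theorem mainTheorem9 :
    -- the spectrum is symmetric about zero, with multiplicities
    (∀ (c : ℝ) (m : ℕ) (x : ℝ),
      (x ∈ spectrum ℝ (StableGap.matH c m) ↔ -x ∈ spectrum ℝ (StableGap.matH c m)) ∧
      (StableGap.eigs c m).count x = (StableGap.eigs c m).count (-x)) ∧
    -- no eigenvalue in the gap for `c ≥ 1`
    (∀ c : ℝ, 1 ≤ c → ∀ m : ℕ,
      StableGap.gap c 0 ∩ spectrum ℝ (StableGap.matH c m) = ∅) ∧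
    -- exactly two exponentially small eigenvalues, both simple, for `0 < c < 1`
    (∀ c : ℝ, 0 < c → c < 1 → ∃ C : ℝ, ∀ m : ℕ, c < m * (1 - c) →
      ∃ μ : ℝ, 0 < μ ∧ μ ≤ C * Real.exp (-(m * StableGap.alpha0 c)) ∧
        StableGap.eigsIn c m (StableGap.gap c 0) = {-μ, μ}) ∧
    -- for `0 < c < 1` and the remaining finitely many small `m` there is none
    (∀ c : ℝ, 0 < c → c < 1 → ∀ m : ℕ, m * (1 - c) ≤ c →
      StableGap.gap c 0 ∩ spectrum ℝ (StableGap.matH c m) = ∅) ∧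
    -- for `c = 0` (formally `α₀ = ∞`) the two eigenvalues are a double zero
    (∀ m : ℕ, 1 ≤ m → StableGap.eigsIn 0 m (StableGap.gap 0 0) = {0, 0}) ∧
    -- maximality of the gap, counting multiplicities; distinct eigenvalues if `c > 0`
    (∀ c : ℝ, 0 ≤ c → ∀ ε : ℝ, 0 < ε → ∀ N : ℕ, ∃ M : ℕ, ∀ m : ℕ, M ≤ m →
      2 * N ≤ Multiset.card (StableGap.eigsIn c m (StableGap.gap c ε)) ∧
      (0 < c → 2 * N ≤ (StableGap.gap c ε ∩ spectrum ℝ (StableGap.matH c m)).ncard)) := by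
  refine ⟨fun c m x => ⟨StableGap.neg_mem_spectrum_matH c x m, StableGap.count_eigs_neg c x m⟩,
    fun c hc m => ?_, fun c h0 h1 => ⟨2, fun m hm => ?_⟩,
    fun c h0 _ m hm => StableGap.gap_inter_spectrum_eq_empty h0 hm,
    fun m hm => StableGap.eigsIn_zero_gap hm, fun c hc ε hε N => ?_⟩
  · refine StableGap.gap_inter_spectrum_eq_empty (by linarith) ?_
    nlinarith [mul_nonneg (Nat.cast_nonneg (α := ℝ) m) (sub_nonneg.2 hc)]
  · rw [StableGap.exp_neg_mul_alpha0 h0 h1]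
    exact StableGap.exists_eigsIn_gap_eq h0 h1 hm
  · rcases hc.eq_or_lt with rfl | hc
    · refine ⟨N + 1, fun m hm => ⟨?_, fun h => absurd h (lt_irrefl 0)⟩⟩
      rw [StableGap.card_eigsIn_zero hε (by omega)]
      omega
    · obtain ⟨M, hM⟩ := StableGap.exists_forall_two_mul_le_ncard hc hε N
      exact ⟨M, fun m hm =>
        ⟨(hM m hm).trans (StableGap.ncard_le_card_eigsIn c ε m), fun _ => hM m hm⟩⟩
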